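/- Let $p,q,\tilde p,\tilde q\in L^1([0,\pi];\mathbb R)$ and $\alpha,\tilde\alpha\in(-\frac{\pi}{2},\frac{\pi}{2}]$. Put $$B=\begin{pmatrix}0&1\\-1&0\end{pmatrix},\qquad \Omega=\begin{pmatrix}p&q\\q&-p\end{pmatrix},\qquad \tilde\Omega=\begin{pmatrix}\tilde p&\tilde q\\\tilde q&-\tilde p\end{pmatrix}.$$ Let $L(\Omega,\alpha)$ be the Dirac operator $\ell y=By'+\Omega y$ in $L^2([0,\pi];\mathbb C^2)$, whose domain consists of the $y=(y_1,y_2)^T$ with absolutely continuous components on $[0,\pi]$ such that $\ell y\in L^2([0,\pi];\mathbb C^2)$, $y_1(0)\cos\alpha+y_2(0)\sin\alpha=0$ and $y_1(\pi)=0$. Its spectrum consists of simple real eigenvalues, discrete and unbounded below and above, denoted $\lambda_n(\Omega,\alpha)$, $n\in\mathbb Z$, and enumerated in increasing order so that $\lambda_n>0$ for $n>0$, $\lambda_n<0$ for $n<0$, and $\lambda_0$ is the eigenvalue nearest to zero (the negative one if there are two nearest). Define $L(\tilde\Omega,\tilde\alpha)$ and $\lambda_n(\tilde\Omega,\tilde\alpha)$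 in the same way. If $L(\Omega,\alpha)$ and $L(\tilde\Omega,\tilde\alpha)$ are isospectral, that is, if $\lambda_n(\Omega,\alpha)=\lambda_n(\tilde\Omega,\tilde\alpha)$ for every $n\in\mathbb Z$, then $\tilde\alpha=\alpha$. -/

import Mathlib

open MeasureTheory Set Real

noncomputable section

/-- The matrix `B` of the canonical Dirac system. -/
def diracB : Matrix (Fin 2) (Fin 2) ℂ := !![0, 1; -1, 0]

/-- The potential matrix `Ω(x)` with entries `p, q, q, -p`, for real-valued `p` and `q`. -/
def diracPotential (p q : ℝ → ℝ) (x : ℝ) : Matrix (Fin 2) (Fin 2) ℂ :=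
  !![(p x : ℂ), (q x : ℂ); (q x : ℂ), -(p x : ℂ)]

/-- The differential expression `ℓ y = B y' + Ω y`. For the absolutely continuous `y` of the
operator domain the componentwise derivative exists almost everywhere. -/
def diracExpr (p q : ℝ → ℝ) (y : ℝ → Fin 2 → ℂ) (x : ℝ) : Fin 2 → ℂ :=
  Matrix.mulVec diracB (fun k => deriv (fun t => y t k) x) +
    Matrix.mulVec (diracPotential p q x) (y x)

/-- The domain of the Dirac operator `L(Ω, α)`. Only the values of `y` on `[0, π]` matter. -/
structure InDiracDomain (p q : ℝ → ℝ) (α : ℝ) (y : ℝ → Fin 2 → ℂ) : Prop where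
  absCont : ∀ k, AbsolutelyContinuousOnInterval (fun x => y x k) 0 π
  expr_memLp : ∀ k, MemLp (fun x => diracExpr p q y x k) 2 (volume.restrict (Icc 0 π))
  bc_zero : y 0 0 * (Real.cos α : ℂ) + y 0 1 * (Real.sin α : ℂ) = 0
  bc_pi : y π 0 = 0

/-- `z ∈ ℂ` is an eigenvalue of `L(Ω, α)`: some nonzero `y` in the domain has `ℓ y = z y`
almost everywhere on `[0, π]`. (As `y` is continuous on `[0, π]`, being nonzero at one point of
`[0, π]` is the same as being nonzero in `L²`.) -/
def IsDiracEigenvalue (p q : ℝ → ℝ) (α : ℝ) (z : ℂ) : Prop :=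
  ∃ y : ℝ → Fin 2 → ℂ, InDiracDomain p q α y ∧ (∃ x ∈ Icc 0 π, y x ≠ 0) ∧
    ∀ᵐ x ∂(volume.restrict (Icc 0 π)), diracExpr p q y x = z • y x

/-- `lam : ℤ → ℝ` is the enumeration of all the eigenvalues of `L(Ω, α)` in increasing order, with
`lam k > 0` for `k > 0`, `lam k < 0` for `k < 0`, and `lam 0` the eigenvalue nearest to zero
(the negative one if there are two nearest ones). -/
structure IsDiracEnumeration (p q : ℝ → ℝ) (α : ℝ) (lam : ℤ → ℝ) : Prop where
  strictMono : StrictMono lam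
  eigenvalue_iff : ∀ z : ℂ, IsDiracEigenvalue p q α z ↔ ∃ n, z = (lam n : ℂ)
  pos : ∀ k, 0 < k → 0 < lam k
  neg : ∀ k, k < 0 → lam k < 0
  nearest : ∀ k, |lam 0| ≤ |lam k|
  tie : ∀ k, |lam k| = |lam 0| → lam 0 ≤ lam k

/-- There is at most one such enumeration. -/
theorem IsDiracEnumeration.unique {p q : ℝ → ℝ} {α : ℝ} {lam mu : ℤ → ℝ}
    (h : IsDiracEnumeration p q α lam) (h' : IsDiracEnumeration p q α mu) : lam = mu := by
  have hr : range lam = range mu := by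
    ext t
    have h1 := h.eigenvalue_iff (t : ℂ)
    rw [h'.eigenvalue_iff] at h1
    simp only [Complex.ofReal_inj] at h1
    simp only [mem_range, eq_comm (b := t)]
    exact h1.symm
  obtain ⟨i, hi⟩ : lam 0 ∈ range mu := hr ▸ mem_range_self 0
  obtain ⟨j, hj⟩ : mu 0 ∈ range lam := hr ▸ mem_range_self 0
  have e1 : |lam 0| = |mu 0| :=
    le_antisymm (hj ▸ h.nearest j) (hi ▸ h'.nearest i)
  have h0 : lam 0 = mu 0 := by
    apply le_antisymm
    · rw [← hj]; exact h.tie j (by rw [hj, e1])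
    · rw [← hi]; exact h'.tie i (by rw [hi, e1])
  have up : ∀ n : ℕ, lam n = mu n ∧ lam (-n) = mu (-n) := by
    have key : ∀ (f g : ℤ → ℝ), StrictMono f → StrictMono g → range f = range g →
        ∀ n : ℤ, f n = g n → f (n + 1) ≤ g (n + 1) ∧ g (n - 1) ≤ f (n - 1) := by
      intro f g hf hg hfg n hn
      constructor
      · obtain ⟨m, hm⟩ : g (n + 1) ∈ range f := hfg ▸ mem_range_self _
        rw [← hm]
        refine hf.monotone ?_
        have : f n < f m := by rw [hm, hn]; exact hg (by omega)
        have := hf.lt_iff_lt.1 this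
        omega
      · obtain ⟨m, hm⟩ : g (n - 1) ∈ range f := hfg ▸ mem_range_self _
        rw [← hm]
        refine hf.monotone ?_
        have : f m < f n := by rw [hm, hn]; exact hg (by omega)
        have := hf.lt_iff_lt.1 this
        omega
    intro n
    induction n with
    | zero => simpa using h0
    | succ n ih =>
      have a := key lam mu h.strictMono h'.strictMono hr
      have b := key mu lam h'.strictMono h.strictMono hr.symm
      push_cast
      refine ⟨le_antisymm (a n ih.1).1 (b n ih.1.symm).1, ?_⟩
      rw [neg_add, ← sub_eq_add_neg]
      exact le_antisymm (b _ ih.2.symm).2 (a _ ih.2).2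
  funext n
  obtain ⟨m, rfl | rfl⟩ := n.eq_nat_or_neg
  · exact (up m).1
  · exact (up m).2

/-- The eigenvalue `λ_n(Ω, α)`: the `n`-th term of the (unique) enumeration of the eigenvalues. -/
def diracEigenvalue (p q : ℝ → ℝ) (α : ℝ) : ℤ → ℝ :=
  Classical.epsilon (IsDiracEnumeration p q α)

/-- `L(Ω, α)` and `L(Ω', α')` are isospectral: `λ_n(Ω, α) = λ_n(Ω', α')` for every `n ∈ ℤ`. -/
def DiracIsospectral (p q : ℝ → ℝ) (α : ℝ) (p' q' : ℝ → ℝ) (α' : ℝ) : Prop :=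
  ∀ n : ℤ, diracEigenvalue p q α n = diracEigenvalue p' q' α' n

end

noncomputable section

open Filter Topology ComplexConjugate
open scoped NNReal

/-! ### Absolutely continuous functions with values in `ℂ` -/

theorem LipschitzOnWith.comp_absolutelyContinuousOnInterval {X Y : Type*} [PseudoMetricSpace X]
    [PseudoMetricSpace Y] {g : X → Y} {f : ℝ → X} {s : Set X} {K : ℝ≥0} {a b : ℝ}
    (hg : LipschitzOnWith K g s) (hf : AbsolutelyContinuousOnInterval f a b)
    (hs : MapsTo f (uIcc a b) s) : AbsolutelyContinuousOnInterval (fun x => g (f x)) a b := by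
  rw [absolutelyContinuousOnInterval_iff] at hf ⊢
  intro ε hε
  obtain ⟨δ, hδ, H⟩ := hf (ε / (K + 1)) (by positivity)
  refine ⟨δ, hδ, fun E hE hlen => ?_⟩
  have h1 := H E hE hlen
  calc ∑ i ∈ Finset.range E.1, dist (g (f (E.2 i).1)) (g (f (E.2 i).2))
      ≤ ∑ i ∈ Finset.range E.1, (K + 1) * dist (f (E.2 i).1) (f (E.2 i).2) := by
        refine Finset.sum_le_sum fun i hi => ?_
        refine (hg.dist_le_mul _ (hs (hE.1 i hi).1) _ (hs (hE.1 i hi).2)).trans ?_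
        gcongr
        linarith
    _ = (K + 1) * ∑ i ∈ Finset.range E.1, dist (f (E.2 i).1) (f (E.2 i).2) := by
        rw [Finset.mul_sum]
    _ < (K + 1) * (ε / (K + 1)) := by gcongr
    _ = ε := by field_simp

namespace AbsolutelyContinuousOnInterval

variable {f g : ℝ → ℂ} {a b : ℝ}

theorem complex_re (hf : AbsolutelyContinuousOnInterval f a b) :
    AbsolutelyContinuousOnInterval (fun x => (f x).re) a b :=
  (Complex.reCLM.lipschitz.lipschitzOnWith (s := univ)).comp_absolutelyContinuousOnInterval hf
    (mapsTo_univ _ _)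

theorem complex_im (hf : AbsolutelyContinuousOnInterval f a b) :
    AbsolutelyContinuousOnInterval (fun x => (f x).im) a b :=
  (Complex.imCLM.lipschitz.lipschitzOnWith (s := univ)).comp_absolutelyContinuousOnInterval hf
    (mapsTo_univ _ _)

theorem complex_conj (hf : AbsolutelyContinuousOnInterval f a b) :
    AbsolutelyContinuousOnInterval (fun x => conj (f x)) a b :=
  (Complex.conjCLE.lipschitz.lipschitzOnWith (s := univ)).comp_absolutelyContinuousOnInterval hf
    (mapsTo_univ _ _)

theorem complex_ofReal {f : ℝ → ℝ} (hf : AbsolutelyContinuousOnInterval f a b) :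
    AbsolutelyContinuousOnInterval (fun x => (f x : ℂ)) a b :=
  (Complex.ofRealCLM.lipschitz.lipschitzOnWith (s := univ)).comp_absolutelyContinuousOnInterval hf
    (mapsTo_univ _ _)

theorem complex_mul (hf : AbsolutelyContinuousOnInterval f a b)
    (hg : AbsolutelyContinuousOnInterval g a b) :
    AbsolutelyContinuousOnInterval (fun x => f x * g x) a b :=
  hf.smul hg

theorem complex_ae_differentiableAt (hf : AbsolutelyContinuousOnInterval f a b) :
    ∀ᵐ x : ℝ, x ∈ uIcc a b → DifferentiableAt ℝ f x := by
  filter_upwards [hf.complex_re.ae_differentiableAt, hf.complex_im.ae_differentiableAt]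
    with x h1 h2 hx
  have e : f = fun x => ((f x).re : ℂ) + ((f x).im : ℂ) * Complex.I := by
    ext x; exact (Complex.re_add_im (f x)).symm
  rw [e]
  exact ((h1 hx).hasDerivAt.ofReal_comp.add
    ((h2 hx).hasDerivAt.ofReal_comp.mul_const Complex.I)).differentiableAt

end AbsolutelyContinuousOnInterval

theorem IntervalIntegrable.complex_ofReal {f : ℝ → ℝ} {a b : ℝ}
    (hf : IntervalIntegrable f volume a b) :
    IntervalIntegrable (fun x => (f x : ℂ)) volume a b :=
  ⟨Integrable.ofReal hf.1, Integrable.ofReal hf.2⟩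

/-- `f` is absolutely continuous between `a` and `b` with almost everywhere derivative `f'`. -/
structure HasACDeriv (f f' : ℝ → ℂ) (a b : ℝ) : Prop where
  ac : AbsolutelyContinuousOnInterval f a b
  ae_hasDerivAt : ∀ᵐ x : ℝ, x ∈ uIcc a b → HasDerivAt f (f' x) x

namespace HasACDeriv

variable {f g f' g' : ℝ → ℂ} {a b : ℝ}

theorem continuousOn (hf : HasACDeriv f f' a b) : ContinuousOn f (uIcc a b) := hf.ac.continuousOn

theorem congr_deriv (hf : HasACDeriv f f' a b) (h : ∀ᵐ x : ℝ, x ∈ uIcc a b → f' x = g' x) :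
    HasACDeriv f g' a b :=
  ⟨hf.ac, by filter_upwards [hf.ae_hasDerivAt, h] with x h1 h2 hx using h2 hx ▸ h1 hx⟩

theorem congr_deriv' (hf : HasACDeriv f f' a b) (h : ∀ x, f' x = g' x) :
    HasACDeriv f g' a b :=
  hf.congr_deriv (ae_of_all _ fun x _ => h x)

theorem add (hf : HasACDeriv f f' a b) (hg : HasACDeriv g g' a b) :
    HasACDeriv (fun x => f x + g x) (fun x => f' x + g' x) a b :=
  ⟨hf.ac.add hg.ac, by
    filter_upwards [hf.ae_hasDerivAt, hg.ae_hasDerivAt] with x h1 h2 hx using (h1 hx).add (h2 hx)⟩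

theorem sub (hf : HasACDeriv f f' a b) (hg : HasACDeriv g g' a b) :
    HasACDeriv (fun x => f x - g x) (fun x => f' x - g' x) a b :=
  ⟨hf.ac.sub hg.ac, by
    filter_upwards [hf.ae_hasDerivAt, hg.ae_hasDerivAt] with x h1 h2 hx using (h1 hx).sub (h2 hx)⟩

theorem mul (hf : HasACDeriv f f' a b) (hg : HasACDeriv g g' a b) :
    HasACDeriv (fun x => f x * g x) (fun x => f' x * g x + f x * g' x) a b :=
  ⟨hf.ac.complex_mul hg.ac, by
    filter_upwards [hf.ae_hasDerivAt, hg.ae_hasDerivAt] with x h1 h2 hx using (h1 hx).mul (h2 hx)⟩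

theorem const_mul (c : ℂ) (hf : HasACDeriv f f' a b) :
    HasACDeriv (fun x => c * f x) (fun x => c * f' x) a b :=
  ⟨hf.ac.const_smul c, by
    filter_upwards [hf.ae_hasDerivAt] with x h1 hx using (h1 hx).const_mul c⟩

theorem complex_conj (hf : HasACDeriv f f' a b) :
    HasACDeriv (fun x => conj (f x)) (fun x => conj (f' x)) a b :=
  ⟨hf.ac.complex_conj, by
    filter_upwards [hf.ae_hasDerivAt] with x h1 hx
    exact Complex.conjCLE.toContinuousLinearMap.hasFDerivAt.comp_hasDerivAt x (h1 hx)⟩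

theorem re (hf : HasACDeriv f f' a b) :
    HasACDeriv (fun x => ((f x).re : ℂ)) (fun x => ((f' x).re : ℂ)) a b :=
  ⟨hf.ac.complex_re.complex_ofReal, by
    filter_upwards [hf.ae_hasDerivAt] with x h1 hx
    exact (Complex.reCLM.hasFDerivAt.comp_hasDerivAt x (h1 hx)).ofReal_comp⟩

theorem im (hf : HasACDeriv f f' a b) :
    HasACDeriv (fun x => ((f x).im : ℂ)) (fun x => ((f' x).im : ℂ)) a b :=
  ⟨hf.ac.complex_im.complex_ofReal, by
    filter_upwards [hf.ae_hasDerivAt] with x h1 hx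
    exact (Complex.imCLM.hasFDerivAt.comp_hasDerivAt x (h1 hx)).ofReal_comp⟩

theorem of_contDiff (hf : ContDiff ℝ 1 f) (h : ∀ x, HasDerivAt f (f' x) x) :
    HasACDeriv f f' a b :=
  ⟨hf.contDiffOn.absolutelyContinuousOnInterval, ae_of_all _ fun x _ => h x⟩

theorem mono {c d : ℝ} (hf : HasACDeriv f f' a b) (h : uIcc c d ⊆ uIcc a b) :
    HasACDeriv f f' c d :=
  ⟨hf.ac.mono h, by filter_upwards [hf.ae_hasDerivAt] with x h1 hx using h1 (h hx)⟩

theorem deriv_re_im_ae_eq (hf : HasACDeriv f f' a b) : ∀ᵐ x : ℝ, x ∈ uIcc a b →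
    (((deriv (fun x => (f x).re) x : ℝ) : ℂ) + ((deriv (fun x => (f x).im) x : ℝ) : ℂ) * Complex.I) = f' x := by
  filter_upwards [hf.ae_hasDerivAt] with x h1 hx
  have e1 : deriv (fun x => (f x).re) x = (f' x).re :=
    (Complex.reCLM.hasFDerivAt.comp_hasDerivAt x (h1 hx)).deriv
  have e2 : deriv (fun x => (f x).im) x = (f' x).im :=
    (Complex.imCLM.hasFDerivAt.comp_hasDerivAt x (h1 hx)).deriv
  rw [e1, e2, Complex.re_add_im]

theorem intervalIntegrable (hf : HasACDeriv f f' a b) : IntervalIntegrable f' volume a b := by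
  have h1 := hf.ac.complex_re.intervalIntegrable_deriv
  have h2 := hf.ac.complex_im.intervalIntegrable_deriv
  have h3 : IntervalIntegrable (fun x => ((deriv (fun x => (f x).re) x : ℝ) : ℂ)
      + ((deriv (fun x => (f x).im) x : ℝ) : ℂ) * Complex.I) volume a b :=
    (IntervalIntegrable.add h1.complex_ofReal
      (h2.complex_ofReal.mul_const Complex.I))
  refine h3.congr_ae ?_
  rw [EventuallyEq, ae_restrict_iff' measurableSet_uIoc]
  filter_upwards [hf.deriv_re_im_ae_eq] with x hx hx'
  exact hx (uIoc_subset_uIcc hx')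

theorem integral_eq_sub (hf : HasACDeriv f f' a b) : ∫ x in a..b, f' x = f b - f a := by
  have h1 := hf.ac.complex_re.intervalIntegrable_deriv
  have h2 := hf.ac.complex_im.intervalIntegrable_deriv
  have e : ∫ x in a..b, f' x = ∫ x in a..b, (((deriv (fun x => (f x).re) x : ℝ) : ℂ)
      + ((deriv (fun x => (f x).im) x : ℝ) : ℂ) * Complex.I) := by
    refine intervalIntegral.integral_congr_ae ?_
    filter_upwards [hf.deriv_re_im_ae_eq] with x hx hx'
    exact (hx (uIoc_subset_uIcc hx')).symm
  rw [e, intervalIntegral.integral_add h1.complex_ofReal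
    (h2.complex_ofReal.mul_const Complex.I),
    intervalIntegral.integral_mul_const, intervalIntegral.integral_ofReal,
    intervalIntegral.integral_ofReal, hf.ac.complex_re.integral_deriv_eq_sub,
    hf.ac.complex_im.integral_deriv_eq_sub]
  apply Complex.ext <;> simp

theorem eq_add_integral (hf : HasACDeriv f f' a b) {x : ℝ} (hx : x ∈ uIcc a b) :
    f x = f a + ∫ t in a..x, f' t := by
  rw [(hf.mono (uIcc_subset_uIcc_left hx)).integral_eq_sub]
  ring

end HasACDeriv

theorem IntervalIntegrable.absolutelyContinuousOnInterval_complex {k : ℝ → ℂ} {a b : ℝ}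
    (hk : IntervalIntegrable k volume a b) :
    AbsolutelyContinuousOnInterval (fun x => ∫ t in a..x, k t) a b := by
  have h1 : IntervalIntegrable (fun t => (k t).re) volume a b := ⟨hk.1.re, hk.2.re⟩
  have h2 : IntervalIntegrable (fun t => (k t).im) volume a b := ⟨hk.1.im, hk.2.im⟩
  have a1 := (h1.absolutelyContinuousOnInterval_intervalIntegral left_mem_uIcc).complex_ofReal
  have a2 := (h2.absolutelyContinuousOnInterval_intervalIntegral left_mem_uIcc).complex_ofReal
  have a3 := a1.add (a2.const_smul Complex.I)
  rw [absolutelyContinuousOnInterval_iff] at a3 ⊢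
  have key : ∀ x ∈ uIcc a b, ∫ t in a..x, k t = ((∫ t in a..x, (k t).re : ℝ) : ℂ)
      + Complex.I • ((∫ t in a..x, (k t).im : ℝ) : ℂ) := by
    intro x hx
    have hkx := hk.mono_set (uIcc_subset_uIcc_left hx)
    have e1 := h1.mono_set (uIcc_subset_uIcc_left hx)
    have e2 := h2.mono_set (uIcc_subset_uIcc_left hx)
    rw [← intervalIntegral.integral_ofReal, ← intervalIntegral.integral_ofReal,
      smul_eq_mul, ← intervalIntegral.integral_const_mul, ← intervalIntegral.integral_add
        e1.complex_ofReal (e2.complex_ofReal.const_mul _)]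
    refine intervalIntegral.integral_congr fun t _ => ?_
    rw [mul_comm, Complex.re_add_im]
  intro ε hε
  obtain ⟨δ, hδ, H⟩ := a3 ε hε
  refine ⟨δ, hδ, fun E hE hlen => lt_of_eq_of_lt ?_ (H E hE hlen)⟩
  refine Finset.sum_congr rfl fun i hi => ?_
  rw [key _ (hE.1 i hi).1, key _ (hE.1 i hi).2]
  rfl

theorem IntervalIntegrable.hasACDeriv_integral {k : ℝ → ℂ} {a b : ℝ}
    (hk : IntervalIntegrable k volume a b) (c : ℂ) :
    HasACDeriv (fun x => c + ∫ t in a..x, k t) k a b := by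
  have h0 : HasACDeriv (fun _ => c) (fun _ => 0) a b :=
    HasACDeriv.of_contDiff contDiff_const fun x => hasDerivAt_const x c
  refine (h0.add (g := fun x => ∫ t in a..x, k t) (g' := k) ⟨?_, ?_⟩).congr_deriv' fun x => by simp
  · exact hk.absolutelyContinuousOnInterval_complex
  · filter_upwards [hk.ae_hasDerivAt_integral] with x hx hx'
    exact hx hx' a left_mem_uIcc

/-! ### The equation `w' = k * conj w` with integrable `k` -/

section ConjLinear

variable {k : ℝ → ℂ} {b : ℝ}

theorem integral_norm_mul_exp_two_mul (hk : IntervalIntegrable k volume 0 b) {x : ℝ}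
    (hx : x ∈ uIcc 0 b) :
    ∫ t in 0..x, ‖k t‖ * rexp (2 * ∫ s in 0..t, ‖k s‖) =
      (rexp (2 * ∫ s in 0..x, ‖k s‖) - 1) / 2 := by
  have hkx := (hk.mono_set (uIcc_subset_uIcc_left hx)).norm
  have h1 : AbsolutelyContinuousOnInterval (fun t => 2 * ∫ s in 0..t, ‖k s‖) 0 x :=
    (hkx.absolutelyContinuousOnInterval_intervalIntegral left_mem_uIcc).const_mul 2
  obtain ⟨C, hC⟩ := h1.exists_bound
  obtain ⟨K, hK⟩ := (Real.contDiff_exp (n := 1)).contDiffOn.exists_lipschitzOnWith (by decide)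
    (convex_Icc (-C) C) isCompact_Icc
  have h2 := hK.comp_absolutelyContinuousOnInterval h1 fun t ht => abs_le.1 (hC t ht)
  have h3 := h2.integral_deriv_eq_sub
  simp only [intervalIntegral.integral_same, mul_zero, Real.exp_zero] at h3
  rw [← h3, eq_div_iff two_ne_zero, ← intervalIntegral.integral_mul_const]
  refine intervalIntegral.integral_congr_ae ?_
  filter_upwards [hkx.ae_hasDerivAt_integral] with t ht ht'
  have h4 := (((ht (uIoc_subset_uIcc ht') 0 left_mem_uIcc).const_mul 2).exp).deriv
  rw [h4]
  ring

theorem continuousOn_integral_norm (hk : IntervalIntegrable k volume 0 b) :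
    ContinuousOn (fun t => ∫ s in 0..t, ‖k s‖) (uIcc 0 b) :=
  (hk.norm.absolutelyContinuousOnInterval_intervalIntegral left_mem_uIcc).continuousOn

theorem integral_norm_mul_le (hb : 0 ≤ b) (hk : IntervalIntegrable k volume 0 b) {v : ℝ → ℝ}
    {m : ℝ} (hm : 0 ≤ m) (hv : ContinuousOn v (Icc 0 b))
    (h : ∀ t ∈ Icc 0 b, v t ≤ m * rexp (2 * ∫ s in 0..t, ‖k s‖)) {x : ℝ} (hx : x ∈ Icc 0 b) :
    ∫ t in 0..x, ‖k t‖ * v t ≤ m / 2 * rexp (2 * ∫ s in 0..x, ‖k s‖) := by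
  have hx' : x ∈ uIcc 0 b := by rwa [uIcc_of_le hb]
  have hsub := uIcc_subset_uIcc_left hx'
  have hkx := (hk.mono_set hsub).norm
  have hc := ((continuousOn_integral_norm hk).mono hsub)
  calc ∫ t in 0..x, ‖k t‖ * v t
      ≤ ∫ t in 0..x, m * (‖k t‖ * rexp (2 * ∫ s in 0..t, ‖k s‖)) := by
        refine intervalIntegral.integral_mono_on hx.1 ?_ ?_ ?_
        · exact hkx.mul_continuousOn (hv.mono (by rwa [uIcc_of_le hb] at hsub))
        · exact (hkx.mul_continuousOn (by fun_prop)).const_mul m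
        · intro t ht
          rw [mul_left_comm]
          exact mul_le_mul_of_nonneg_left (h t ⟨ht.1, ht.2.trans hx.2⟩) (norm_nonneg _)
    _ = m * ((rexp (2 * ∫ s in 0..x, ‖k s‖) - 1) / 2) := by
        rw [intervalIntegral.integral_const_mul, integral_norm_mul_exp_two_mul hk hx']
    _ ≤ _ := by nlinarith

/-- A Grönwall inequality with an integrable coefficient. -/
theorem norm_le_of_le_add_integral_norm_mul (hb : 0 ≤ b) (hk : IntervalIntegrable k volume 0 b)
    {u : ℝ → ℂ} (hu : ContinuousOn u (Icc 0 b)) {C : ℝ}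
    (h : ∀ x ∈ Icc 0 b, ‖u x‖ ≤ C + ∫ t in 0..x, ‖k t‖ * ‖u t‖) {x : ℝ} (hx : x ∈ Icc 0 b) :
    ‖u x‖ ≤ 2 * C * rexp (2 * ∫ s in 0..b, ‖k s‖) := by
  have hC : 0 ≤ C := by simpa using (norm_nonneg _).trans (h 0 (left_mem_Icc.2 hb))
  have hnn : ∀ t ∈ Icc 0 b, 0 ≤ ∫ s in 0..t, ‖k s‖ := fun t ht =>
    intervalIntegral.integral_nonneg ht.1 fun s _ => norm_nonneg _
  have hM := continuousOn_integral_norm hk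
  rw [uIcc_of_le hb] at hM
  obtain ⟨x₀, hx₀, hmax⟩ := isCompact_Icc.exists_isMaxOn (nonempty_Icc.2 hb)
    (f := fun t => ‖u t‖ * rexp (-(2 * ∫ s in 0..t, ‖k s‖))) (by fun_prop)
  set m := ‖u x₀‖ * rexp (-(2 * ∫ s in 0..x₀, ‖k s‖)) with hm
  have hm0 : 0 ≤ m := by positivity
  have hle : ∀ t ∈ Icc 0 b, ‖u t‖ ≤ m * rexp (2 * ∫ s in 0..t, ‖k s‖) := by
    intro t ht
    have h1 : ‖u t‖ * rexp (-(2 * ∫ s in 0..t, ‖k s‖)) ≤ m := hmax ht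
    rwa [Real.exp_neg, ← div_eq_mul_inv, div_le_iff₀ (Real.exp_pos _)] at h1
  have hmC : m ≤ 2 * C := by
    have h1 := (h x₀ hx₀).trans
      (add_le_add_right (integral_norm_mul_le hb hk hm0 hu.norm hle hx₀) C)
    have h2 : m ≤ (C + m / 2 * rexp (2 * ∫ s in 0..x₀, ‖k s‖)) *
        rexp (-(2 * ∫ s in 0..x₀, ‖k s‖)) := by
      rw [hm]; gcongr
    rw [add_mul, mul_assoc, ← Real.exp_add, add_neg_cancel, Real.exp_zero] at h2
    have h3 : C * rexp (-(2 * ∫ s in 0..x₀, ‖k s‖)) ≤ C :=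
      mul_le_of_le_one_right hC (Real.exp_le_one_iff.2 (by linarith [hnn x₀ hx₀]))
    linarith
  refine (hle x hx).trans ?_
  gcongr
  exact intervalIntegral.integral_mono_interval le_rfl hx.1 hx.2
    (ae_of_all _ fun _ => norm_nonneg _) hk.norm

theorem exists_hasACDeriv_mul_conj (hb : 0 ≤ b) (hk : IntervalIntegrable k volume 0 b) (c : ℂ) :
    ∃ w : ℝ → ℂ, w 0 = c ∧ HasACDeriv w (fun t => k t * conj (w t)) 0 b := by
  set M : ℝ → ℝ := fun t => ∫ s in 0..t, ‖k s‖ with hMdef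
  have hM : ContinuousOn M (Icc 0 b) := by
    have := continuousOn_integral_norm hk
    rwa [uIcc_of_le hb] at this
  have hint : ∀ v : C(Icc 0 b, ℂ), IntervalIntegrable
      (fun t => k t * (rexp (2 * M t) * conj (IccExtend hb v t))) volume 0 b := by
    intro v
    refine hk.mul_continuousOn ?_
    rw [uIcc_of_le hb]
    have h1 : Continuous (IccExtend hb v) := v.continuous.Icc_extend'
    have h2 : ContinuousOn (fun t => ((rexp (2 * M t) : ℝ) : ℂ)) (Icc 0 b) := by fun_prop
    exact h2.mul (Complex.continuous_conj.comp h1).continuousOn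
  have hcont : ∀ v : C(Icc 0 b, ℂ), ContinuousOn (fun x : ℝ => (rexp (-(2 * M x)) : ℂ) *
      (c + ∫ t in 0..x, k t * (rexp (2 * M t) * conj (IccExtend hb v t)))) (Icc 0 b) := by
    intro v
    have h1 := ((hint v).hasACDeriv_integral c).continuousOn
    rw [uIcc_of_le hb] at h1
    have h2 : ContinuousOn (fun t => ((rexp (-(2 * M t)) : ℝ) : ℂ)) (Icc 0 b) := by fun_prop
    exact h2.mul h1
  let T : C(Icc 0 b, ℂ) → C(Icc 0 b, ℂ) := fun v => ⟨_, (hcont v).domRestrict⟩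
  have hT : ContractingWith (1 / 2) T := by
    refine ⟨by rw [← NNReal.coe_lt_coe]; norm_num, LipschitzWith.of_dist_le_mul fun v u => ?_⟩
    rw [ContinuousMap.dist_le (by positivity)]
    rintro ⟨x, hx⟩
    have hx' : x ∈ uIcc 0 b := by rwa [uIcc_of_le hb]
    have hsub := uIcc_subset_uIcc_left hx'
    have e : T v ⟨x, hx⟩ - T u ⟨x, hx⟩ = (rexp (-(2 * M x)) : ℂ) *
        ∫ t in 0..x, k t * (rexp (2 * M t) * conj (IccExtend hb v t - IccExtend hb u t)) := by
      have e1 : ∫ t in 0..x, k t * (rexp (2 * M t) * conj (IccExtend hb v t - IccExtend hb u t))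
          = (∫ t in 0..x, k t * (rexp (2 * M t) * conj (IccExtend hb v t)))
            - ∫ t in 0..x, k t * (rexp (2 * M t) * conj (IccExtend hb u t)) := by
        rw [← intervalIntegral.integral_sub ((hint v).mono_set hsub) ((hint u).mono_set hsub)]
        refine intervalIntegral.integral_congr fun t _ => ?_
        simp only [map_sub]
        ring
      rw [e1]
      simp only [T, ContinuousMap.coe_mk, domRestrict_apply]
      ring
    have hbound : ‖∫ t in 0..x, k t * (rexp (2 * M t) *
        conj (IccExtend hb v t - IccExtend hb u t))‖ ≤ dist v u / 2 * rexp (2 * M x) := by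
      refine (intervalIntegral.norm_integral_le_integral_norm hx.1).trans ?_
      have hv : ContinuousOn (fun t => rexp (2 * M t) * ‖IccExtend hb v t - IccExtend hb u t‖)
          (Icc 0 b) := by
        have h1 : Continuous (IccExtend hb v) := v.continuous.Icc_extend'
        have h2 : Continuous (IccExtend hb u) := u.continuous.Icc_extend'
        fun_prop
      refine le_trans (le_of_eq ?_) (integral_norm_mul_le hb hk dist_nonneg hv ?_ hx)
      · refine intervalIntegral.integral_congr fun t _ => ?_
        simp only [norm_mul, RCLike.norm_conj, Complex.norm_real, Real.norm_eq_abs, Real.abs_exp]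
      · intro t ht
        rw [mul_comm]
        gcongr
        rw [← dist_eq_norm]
        exact ContinuousMap.dist_apply_le_dist _
    rw [dist_eq_norm, e, norm_mul, Complex.norm_real, Real.norm_eq_abs, Real.abs_exp]
    calc rexp (-(2 * M x)) * _ ≤ rexp (-(2 * M x)) * (dist v u / 2 * rexp (2 * M x)) := by gcongr
      _ = (rexp (-(2 * M x)) * rexp (2 * M x)) * (dist v u / 2) := by ring
      _ = ((1 / 2 : ℝ≥0) : ℝ) * dist v u := by
        rw [← Real.exp_add, neg_add_cancel, Real.exp_zero]
        push_cast
        ring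
  set v := hT.fixedPoint T with hv
  have hfix : T v = v := hT.fixedPoint_isFixedPt
  refine ⟨fun x => c + ∫ t in 0..x, k t * (rexp (2 * M t) * conj (IccExtend hb v t)), by simp,
    ((hint v).hasACDeriv_integral c).congr_deriv (ae_of_all _ fun x hx => ?_)⟩
  rw [uIcc_of_le hb] at hx
  have h1 : T v ⟨x, hx⟩ = v ⟨x, hx⟩ := by rw [hfix]
  simp only [T, ContinuousMap.coe_mk, domRestrict_apply] at h1
  rw [IccExtend_of_mem hb _ hx, ← h1]
  simp only [map_mul, Complex.conj_ofReal]
  rw [← mul_assoc (rexp (2 * M x) : ℂ), ← Complex.ofReal_mul, ← Real.exp_add, add_neg_cancel,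
    Real.exp_zero, Complex.ofReal_one, one_mul]

end ConjLinear

section Oscillating

/-- The function `h(t) e^{-2iλt}` for the spectral parameter `λ = l`. -/
def modulated (h : ℝ → ℂ) (l t : ℝ) : ℂ := h t * Complex.exp ((-(2 * l * t) : ℝ) * Complex.I)

variable {h : ℝ → ℂ} {b : ℝ}

theorem norm_modulated (h : ℝ → ℂ) (l t : ℝ) : ‖modulated h l t‖ = ‖h t‖ := by
  rw [modulated, norm_mul, Complex.norm_exp_ofReal_mul_I, mul_one]

theorem IntervalIntegrable.modulated {a : ℝ} (hh : IntervalIntegrable h volume a b) (l : ℝ) :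
    IntervalIntegrable (modulated h l) volume a b :=
  hh.mul_continuousOn (by fun_prop)

theorem norm_modulated_sub_le (h : ℝ → ℂ) (l m : ℝ) {t : ℝ} (ht : 0 ≤ t) :
    ‖modulated h l t - modulated h m t‖ ≤ ‖h t‖ * (2 * t * |l - m|) := by
  have e : modulated h l t - modulated h m t = modulated h m t *
      (Complex.exp (Complex.I * ((-(2 * (l - m) * t) : ℝ) : ℂ)) - 1) := by
    rw [modulated, modulated, mul_sub, mul_one, mul_assoc (h t), ← Complex.exp_add]
    congr 3
    push_cast
    ring
  rw [e, norm_mul, norm_modulated]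
  gcongr
  refine (Real.norm_exp_I_mul_ofReal_sub_one_le).trans (le_of_eq ?_)
  rw [Real.norm_eq_abs, abs_neg, abs_mul, abs_mul, abs_two, abs_of_nonneg ht]
  ring

theorem tendsto_integral_modulated (h : ℝ → ℂ) {x : ℝ} (hx : 0 ≤ x) :
    Tendsto (fun l : ℝ => ∫ t in 0..x, modulated h l t) (cocompact ℝ) (𝓝 0) := by
  have h1 := Real.tendsto_integral_exp_smul_cocompact ((Ioc 0 x).indicator h)
  have h2 : Tendsto (fun l : ℝ => l * π⁻¹) (cocompact ℝ) (cocompact ℝ) :=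
    (Homeomorph.mulRight₀ π⁻¹ (by positivity)).isClosedEmbedding.tendsto_cocompact
  refine (h1.comp h2).congr fun l => ?_
  rw [Function.comp_apply, intervalIntegral.integral_of_le hx,
    ← integral_indicator measurableSet_Ioc]
  refine integral_congr_ae (ae_of_all _ fun t => ?_)
  by_cases ht : t ∈ Ioc 0 x
  · simp only [indicator_of_mem ht, modulated, Circle.smul_def, Real.fourierChar_apply, smul_eq_mul]
    rw [mul_comm]
    congr 3
    field_simp
  · simp [indicator_of_notMem ht]

variable {W : ℝ → ℝ → ℂ} {c : ℂ}

theorem norm_le_of_hasACDeriv_modulated (hb : 0 ≤ b) (hh : IntervalIntegrable h volume 0 b)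
    (hW0 : ∀ l, W l 0 = c)
    (hW : ∀ l, HasACDeriv (W l) (fun t => modulated h l t * conj (W l t)) 0 b)
    (l : ℝ) {x : ℝ} (hx : x ∈ Icc 0 b) :
    ‖W l x‖ ≤ 2 * ‖c‖ * rexp (2 * ∫ t in 0..b, ‖h t‖) := by
  have hc := (hW l).continuousOn
  rw [uIcc_of_le hb] at hc
  refine norm_le_of_le_add_integral_norm_mul hb hh hc (fun y hy => ?_) hx
  rw [(hW l).eq_add_integral (by rwa [uIcc_of_le hb]), hW0]
  refine (norm_add_le _ _).trans ?_
  gcongr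
  refine (intervalIntegral.norm_integral_le_integral_norm hy.1).trans (le_of_eq ?_)
  refine intervalIntegral.integral_congr fun t _ => ?_
  simp only [norm_mul, norm_modulated, RCLike.norm_conj]

theorem exists_norm_sub_le_of_hasACDeriv_modulated (hb : 0 ≤ b)
    (hh : IntervalIntegrable h volume 0 b) (hW0 : ∀ l, W l 0 = c)
    (hW : ∀ l, HasACDeriv (W l) (fun t => modulated h l t * conj (W l t)) 0 b) :
    ∃ K : ℝ, ∀ l m, ∀ x ∈ Icc 0 b, ‖W l x - W m x‖ ≤ K * |l - m| := by
  set B := 2 * ‖c‖ * rexp (2 * ∫ t in 0..b, ‖h t‖) with hB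
  have hB0 : 0 ≤ B := by positivity
  refine ⟨2 * ((∫ t in 0..b, ‖h t‖) * (2 * b * B)) * rexp (2 * ∫ t in 0..b, ‖h t‖),
    fun l m x hx => ?_⟩
  have hd := (hW l).sub (hW m)
  have hc := hd.continuousOn
  rw [uIcc_of_le hb] at hc
  refine le_trans (norm_le_of_le_add_integral_norm_mul hb hh hc
    (C := (∫ t in 0..b, ‖h t‖) * (2 * b * B) * |l - m|) (fun y hy => ?_) hx) (le_of_eq (by ring))
  have hy' : y ∈ uIcc 0 b := by rwa [uIcc_of_le hb]
  have hsub := uIcc_subset_uIcc_left hy'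
  have hhy := hh.mono_set hsub
  rw [hd.eq_add_integral hy', hW0, hW0, sub_self, zero_add]
  refine (intervalIntegral.norm_integral_le_integral_norm hy.1).trans ?_
  have i1 : IntervalIntegrable (fun t => ‖h t‖ * (2 * b * B * |l - m|)) volume 0 y :=
    hhy.norm.mul_const _
  have i2 : IntervalIntegrable (fun t => ‖h t‖ * ‖W l t - W m t‖) volume 0 y :=
    hhy.norm.mul_continuousOn (hd.continuousOn.mono hsub).norm
  calc _ ≤ ∫ t in 0..y, (‖h t‖ * (2 * b * B * |l - m|) + ‖h t‖ * ‖W l t - W m t‖) := by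
        refine intervalIntegral.integral_mono_on hy.1
          (hd.intervalIntegrable.mono_set hsub).norm (i1.add i2) fun t ht => ?_
        have ht' : t ∈ Icc 0 b := ⟨ht.1, ht.2.trans hy.2⟩
        have e : modulated h l t * conj (W l t) - modulated h m t * conj (W m t) =
            (modulated h l t - modulated h m t) * conj (W m t) +
              modulated h l t * conj (W l t - W m t) := by
          rw [map_sub]; ring
        rw [e]
        refine (norm_add_le _ _).trans ?_
        rw [norm_mul, norm_mul, RCLike.norm_conj, RCLike.norm_conj, norm_modulated]
        refine add_le_add ?_ le_rfl
        have ht0 : 0 ≤ t := ht.1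
        calc ‖modulated h l t - modulated h m t‖ * ‖W m t‖
            ≤ ‖h t‖ * (2 * t * |l - m|) * B := by
              gcongr
              · exact norm_modulated_sub_le h l m ht.1
              · exact norm_le_of_hasACDeriv_modulated hb hh hW0 hW m ht'
          _ ≤ ‖h t‖ * (2 * b * |l - m|) * B := by gcongr; exact ht'.2
          _ = _ := by ring
    _ = (∫ t in 0..y, ‖h t‖) * (2 * b * B * |l - m|) + ∫ t in 0..y, ‖h t‖ * ‖W l t - W m t‖ := by
        rw [intervalIntegral.integral_add i1 i2, intervalIntegral.integral_mul_const]
    _ ≤ (∫ t in 0..b, ‖h t‖) * (2 * b * B * |l - m|) + ∫ t in 0..y, ‖h t‖ * ‖W l t - W m t‖ := by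
        gcongr
        exact intervalIntegral.integral_mono_interval le_rfl hy.1 hy.2
          (ae_of_all _ fun _ => norm_nonneg _) hh.norm
    _ = _ := by ring

theorem tendsto_of_hasACDeriv_modulated (hb : 0 ≤ b) (hh : IntervalIntegrable h volume 0 b)
    (hW0 : ∀ l, W l 0 = c)
    (hW : ∀ l, HasACDeriv (W l) (fun t => modulated h l t * conj (W l t)) 0 b)
    {F : Filter ℝ} [F.IsCountablyGenerated] (hF : F ≤ cocompact ℝ) :
    Tendsto (fun l => W l b) F (𝓝 c) := by
  set B := 2 * ‖c‖ * rexp (2 * ∫ t in 0..b, ‖h t‖) with hB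
  have hWB : ∀ l, ∀ x ∈ Icc 0 b, ‖W l x‖ ≤ B := fun l x hx =>
    norm_le_of_hasACDeriv_modulated hb hh hW0 hW l hx
  set H : ℝ → ℝ → ℂ := fun l x => ∫ t in 0..x, modulated h l t with hH
  have hHlim : ∀ x ∈ Icc 0 b, Tendsto (fun l => H l x) F (𝓝 0) := fun x hx =>
    (tendsto_integral_modulated h hx.1).mono_left hF
  have hHd : ∀ l, HasACDeriv (H l) (modulated h l) 0 b := fun l => by
    simpa using! (hh.modulated l).hasACDeriv_integral 0
  have hHle : ∀ l, ∀ x ∈ Icc 0 b, ‖H l x‖ ≤ ∫ t in 0..b, ‖h t‖ := by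
    intro l x hx
    refine (intervalIntegral.norm_integral_le_integral_norm hx.1).trans ?_
    simp only [norm_modulated]
    exact intervalIntegral.integral_mono_interval le_rfl hx.1 hx.2
      (ae_of_all _ fun _ => norm_nonneg _) hh.norm
  have hprod : ∀ l, HasACDeriv (fun t => H l t * conj (W l t))
      (fun t => modulated h l t * conj (W l t) + H l t * (conj (modulated h l t) * W l t)) 0 b :=
    fun l => ((hHd l).mul (hW l).complex_conj).congr_deriv' fun x => by simp
  have hrem : ∀ l, IntervalIntegrable (fun t => H l t * (conj (modulated h l t) * W l t))
      volume 0 b := fun l => by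
    have := (hprod l).intervalIntegrable.sub (hW l).intervalIntegrable
    simpa using this
  have hrepr : ∀ l, W l b = c + H l b * conj (W l b) -
      ∫ t in 0..b, H l t * (conj (modulated h l t) * W l t) := by
    intro l
    have h1 := (hW l).eq_add_integral right_mem_uIcc
    have h2 := (hprod l).integral_eq_sub
    rw [intervalIntegral.integral_add (hW l).intervalIntegrable (hrem l)] at h2
    simp only [hH, intervalIntegral.integral_same, zero_mul, sub_zero] at h2
    rw [hW0] at h1
    rw [← h2]
    linear_combination h1
  have hlim1 : Tendsto (fun l => H l b * conj (W l b)) F (𝓝 0) := by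
    refine squeeze_zero_norm (a := fun l => ‖H l b‖ * B) (fun l => ?_) ?_
    · rw [norm_mul, RCLike.norm_conj]
      gcongr
      exact hWB l b (right_mem_Icc.2 hb)
    · simpa using (hHlim b (right_mem_Icc.2 hb)).norm.mul_const B
  have hlim2 : Tendsto (fun l => ∫ t in 0..b, H l t * (conj (modulated h l t) * W l t)) F
      (𝓝 (∫ t in 0..b, (0 : ℂ))) := by
    refine intervalIntegral.tendsto_integral_filter_of_dominated_convergence
      (fun t => (∫ t in 0..b, ‖h t‖) * (‖h t‖ * B)) ?_ ?_ ?_ ?_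
    · exact Eventually.of_forall fun l => by
        have := (hrem l).aestronglyMeasurable
        rwa [uIoc_of_le hb]
    · refine Eventually.of_forall fun l => ae_of_all _ fun t ht => ?_
      rw [uIoc_of_le hb] at ht
      have ht' := Ioc_subset_Icc_self ht
      rw [norm_mul, norm_mul, RCLike.norm_conj, norm_modulated]
      gcongr
      · exact intervalIntegral.integral_nonneg hb fun _ _ => norm_nonneg _
      · exact hHle l t ht'
      · exact hWB l t ht'
    · exact (hh.norm.mul_const B).const_mul _
    · refine ae_of_all _ fun t ht => ?_
      rw [uIoc_of_le hb] at ht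
      have ht' := Ioc_subset_Icc_self ht
      refine squeeze_zero_norm (a := fun l => ‖H l t‖ * (‖h t‖ * B)) (fun l => ?_) ?_
      · rw [norm_mul, norm_mul, RCLike.norm_conj, norm_modulated]
        gcongr
        exact hWB l t ht'
      · simpa using (hHlim t ht').norm.mul_const (‖h t‖ * B)
  rw [intervalIntegral.integral_zero] at hlim2
  have h3 := (hlim1.const_add c).sub hlim2
  rw [add_zero, sub_zero] at h3
  exact h3.congr fun l => (hrepr l).symm

end Oscillating

/-! ### The Dirac system in complex form -/

/-- The coefficient `q - i p` of the scalar form `ζ' = i λ ζ + (q - i p) ζ̄` of the Dirac system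
for `ζ = y₁ + i y₂`. -/
def diracCoeff (p q : ℝ → ℝ) (t : ℝ) : ℂ := q t - Complex.I * p t

/-- `Z l` solves the scalar form of the Dirac system with spectral parameter `l` and initial value
`i e^{iα}`. -/
structure IsDiracSolutionFamily (p q : ℝ → ℝ) (α : ℝ) (Z : ℝ → ℝ → ℂ) : Prop where
  init : ∀ l, Z l 0 = Complex.I * Complex.exp (α * Complex.I)
  hasACDeriv : ∀ l, HasACDeriv (Z l)
    (fun x => Complex.I * l * Z l x + diracCoeff p q x * conj (Z l x)) 0 π

variable {p q : ℝ → ℝ} {α : ℝ} {Z : ℝ → ℝ → ℂ}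

theorem intervalIntegrable_diracCoeff (hp : IntegrableOn p (Icc 0 π))
    (hq : IntegrableOn q (Icc 0 π)) : IntervalIntegrable (diracCoeff p q) volume 0 π := by
  rw [integrableOn_Icc_iff_integrableOn_Ioc,
    ← intervalIntegrable_iff_integrableOn_Ioc_of_le pi_pos.le] at hp hq
  exact hq.complex_ofReal.sub (hp.complex_ofReal.const_mul Complex.I)

theorem hasACDeriv_exp_mul_I (l : ℝ) (a b : ℝ) :
    HasACDeriv (fun x : ℝ => Complex.exp ((l * x : ℝ) * Complex.I))
      (fun x => Complex.I * l * Complex.exp ((l * x : ℝ) * Complex.I)) a b := by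
  refine HasACDeriv.of_contDiff (((Complex.ofRealCLM.contDiff.comp
    (contDiff_const.mul contDiff_id)).mul contDiff_const).cexp) fun x => ?_
  have h1 : HasDerivAt (fun x : ℝ => ((l * x : ℝ) : ℂ) * Complex.I) ((l : ℂ) * Complex.I) x := by
    have h2 := ((((hasDerivAt_id x).const_mul l).ofReal_comp)).mul_const Complex.I
    simpa using! h2
  convert! h1.cexp using 1
  ring

theorem hasACDeriv_exp_mul {h f : ℝ → ℂ} {l a b : ℝ}
    (hf : HasACDeriv f (fun x => modulated h l x * conj (f x)) a b) :
    HasACDeriv (fun x => Complex.exp ((l * x : ℝ) * Complex.I) * f x)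
      (fun x => Complex.I * l * (Complex.exp ((l * x : ℝ) * Complex.I) * f x) +
        h x * conj (Complex.exp ((l * x : ℝ) * Complex.I) * f x)) a b := by
  refine ((hasACDeriv_exp_mul_I l a b).mul hf).congr_deriv' fun x => ?_
  have e : Complex.exp ((l * x : ℝ) * Complex.I) * Complex.exp ((-(2 * l * x) : ℝ) * Complex.I)
      = conj (Complex.exp ((l * x : ℝ) * Complex.I)) := by
    rw [← Complex.exp_conj, ← Complex.exp_add]
    congr 1
    simp only [map_mul, Complex.conj_ofReal, Complex.conj_I]
    push_cast
    ring
  rw [map_mul, ← e, modulated]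
  ring

theorem hasACDeriv_exp_neg_mul {h f : ℝ → ℂ} {l a b : ℝ}
    (hf : HasACDeriv f (fun x => Complex.I * l * f x + h x * conj (f x)) a b) :
    HasACDeriv (fun x => Complex.exp ((-l * x : ℝ) * Complex.I) * f x)
      (fun x => modulated h l x * conj (Complex.exp ((-l * x : ℝ) * Complex.I) * f x)) a b := by
  refine ((hasACDeriv_exp_mul_I (-l) a b).mul hf).congr_deriv' fun x => ?_
  have e : Complex.exp ((-(2 * l * x) : ℝ) * Complex.I) *
      conj (Complex.exp ((-l * x : ℝ) * Complex.I)) = Complex.exp ((-l * x : ℝ) * Complex.I) := by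
    rw [← Complex.exp_conj, ← Complex.exp_add]
    congr 1
    simp only [map_mul, Complex.conj_ofReal, Complex.conj_I]
    push_cast
    ring
  rw [map_mul, modulated, mul_assoc (h x), ← mul_assoc _ _ (conj (f x)), e]
  push_cast
  ring

/-- A solution of `f' = i λ f + h f̄` that vanishes at `0` is zero. -/
theorem eq_zero_of_hasACDeriv {h f : ℝ → ℂ} {l b : ℝ} (hb : 0 ≤ b)
    (hh : IntervalIntegrable h volume 0 b)
    (hf : HasACDeriv f (fun x => Complex.I * l * f x + h x * conj (f x)) 0 b) (h0 : f 0 = 0)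
    {x : ℝ} (hx : x ∈ Icc 0 b) : f x = 0 := by
  have hw := hasACDeriv_exp_neg_mul hf
  have := norm_le_of_hasACDeriv_modulated (W := fun m x => if m = l then
      Complex.exp ((-l * x : ℝ) * Complex.I) * f x else 0) (c := 0) hb hh
      (fun m => by simp [h0]) (fun m => ?_) l hx
  · simpa only [if_true, norm_zero, mul_zero, zero_mul, norm_mul, Complex.norm_exp_ofReal_mul_I,
      one_mul, norm_le_zero_iff] using this
  · by_cases hm : m = l
    · simpa [hm] using hw
    · simpa [hm] using HasACDeriv.of_contDiff contDiff_const fun x => hasDerivAt_const x (0 : ℂ)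

theorem exists_isDiracSolutionFamily (hp : IntegrableOn p (Icc 0 π))
    (hq : IntegrableOn q (Icc 0 π)) (α : ℝ) : ∃ Z, IsDiracSolutionFamily p q α Z := by
  have hh := intervalIntegrable_diracCoeff hp hq
  choose W hW0 hW using fun l => exists_hasACDeriv_mul_conj pi_pos.le (hh.modulated l)
    (Complex.I * Complex.exp (α * Complex.I))
  exact ⟨fun l x => Complex.exp ((l * x : ℝ) * Complex.I) * W l x,
    fun l => by simp [hW0], fun l => hasACDeriv_exp_mul (hW l)⟩

namespace IsDiracSolutionFamily

theorem exists_norm_sub_le (hZ : IsDiracSolutionFamily p q α Z) (hp : IntegrableOn p (Icc 0 π))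
    (hq : IntegrableOn q (Icc 0 π)) :
    ∃ K : ℝ, ∀ l m, ∀ x ∈ Icc 0 π, ‖Z l x - Z m x‖ ≤ K * |l - m| := by
  have hh := intervalIntegrable_diracCoeff hp hq
  set W : ℝ → ℝ → ℂ := fun l x => Complex.exp ((-l * x : ℝ) * Complex.I) * Z l x with hWdef
  have hW : ∀ l, HasACDeriv (W l) (fun t => modulated (diracCoeff p q) l t * conj (W l t)) 0 π :=
    fun l => hasACDeriv_exp_neg_mul (hZ.hasACDeriv l)
  have hW0 : ∀ l, W l 0 = Complex.I * Complex.exp (α * Complex.I) := fun l => by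
    simp [hWdef, hZ.init]
  obtain ⟨K, hK⟩ := exists_norm_sub_le_of_hasACDeriv_modulated pi_pos.le hh hW0 hW
  have hB := norm_le_of_hasACDeriv_modulated pi_pos.le hh hW0 hW
  set B := 2 * ‖Complex.I * Complex.exp (α * Complex.I)‖ *
    rexp (2 * ∫ t in 0..π, ‖diracCoeff p q t‖)
  refine ⟨K + π * B, fun l m x hx => ?_⟩
  have hZW : ∀ l, Z l x = Complex.exp ((l * x : ℝ) * Complex.I) * W l x := fun l => by
    rw [hWdef, ← mul_assoc, ← Complex.exp_add]
    push_cast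
    rw [← add_mul, neg_mul, add_neg_cancel, zero_mul, Complex.exp_zero, one_mul]
  have e : Z l x - Z m x = Complex.exp ((l * x : ℝ) * Complex.I) * (W l x - W m x) +
      Complex.exp ((m * x : ℝ) * Complex.I) *
        (Complex.exp (Complex.I * (((l - m) * x : ℝ) : ℂ)) - 1) * W m x := by
    have e1 : Complex.exp ((m * x : ℝ) * Complex.I) *
        Complex.exp (Complex.I * (((l - m) * x : ℝ) : ℂ)) =
          Complex.exp ((l * x : ℝ) * Complex.I) := by
      rw [← Complex.exp_add]
      congr 1
      push_cast
      ring
    rw [hZW l, hZW m, mul_sub _ _ (1 : ℂ), e1]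
    ring
  rw [e]
  refine (norm_add_le _ _).trans ?_
  rw [norm_mul, norm_mul, norm_mul, Complex.norm_exp_ofReal_mul_I, Complex.norm_exp_ofReal_mul_I,
    one_mul, one_mul, add_mul]
  refine add_le_add (hK l m x hx) ?_
  have h1 : ‖Complex.exp (Complex.I * (((l - m) * x : ℝ) : ℂ)) - 1‖ ≤ π * |l - m| := by
    refine (Real.norm_exp_I_mul_ofReal_sub_one_le).trans ?_
    rw [Real.norm_eq_abs, abs_mul, mul_comm, abs_of_nonneg hx.1]
    exact mul_le_mul_of_nonneg_right hx.2 (abs_nonneg _)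
  calc _ ≤ (π * |l - m|) * B := mul_le_mul h1 (hB m hx) (norm_nonneg _) (by positivity)
    _ = _ := by ring

theorem continuous_eval (hZ : IsDiracSolutionFamily p q α Z) (hp : IntegrableOn p (Icc 0 π))
    (hq : IntegrableOn q (Icc 0 π)) {x : ℝ} (hx : x ∈ Icc 0 π) : Continuous fun l => Z l x := by
  obtain ⟨K, hK⟩ := hZ.exists_norm_sub_le hp hq
  refine LipschitzWith.continuous (K := K.toNNReal) (LipschitzWith.of_dist_le_mul fun l m => ?_)
  rw [dist_eq_norm, Real.dist_eq]
  refine (hK l m x hx).trans ?_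
  gcongr
  exact Real.le_coe_toNNReal K

theorem tendsto_re_add_sin (hZ : IsDiracSolutionFamily p q α Z) (hp : IntegrableOn p (Icc 0 π))
    (hq : IntegrableOn q (Icc 0 π)) {F : Filter ℝ} [F.IsCountablyGenerated]
    (hF : F ≤ cocompact ℝ) :
    Tendsto (fun l => (Z l π).re + Real.sin (l * π + α)) F (𝓝 0) := by
  have hh := intervalIntegrable_diracCoeff hp hq
  have h1 := tendsto_of_hasACDeriv_modulated pi_pos.le hh
    (W := fun l x => Complex.exp ((-l * x : ℝ) * Complex.I) * Z l x)
    (c := Complex.I * Complex.exp (α * Complex.I)) (fun l => by simp [hZ.init])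
    (fun l => hasACDeriv_exp_neg_mul (hZ.hasACDeriv l)) hF
  rw [tendsto_iff_norm_sub_tendsto_zero] at h1
  refine squeeze_zero_norm (fun l => ?_) h1
  have e : Complex.exp ((-l * π : ℝ) * Complex.I) * Z l π - Complex.I * Complex.exp (α * Complex.I)
      = Complex.exp ((-l * π : ℝ) * Complex.I) *
        (Z l π - Complex.I * Complex.exp ((l * π + α : ℝ) * Complex.I)) := by
    have e1 : Complex.exp (α * Complex.I) = Complex.exp ((-l * π : ℝ) * Complex.I) *
        Complex.exp ((l * π + α : ℝ) * Complex.I) := by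
      rw [← Complex.exp_add]
      congr 1
      push_cast
      ring
    rw [e1]
    ring
  rw [e, norm_mul, Complex.norm_exp_ofReal_mul_I, one_mul]
  refine le_trans (le_of_eq ?_) (Complex.abs_re_le_norm _)
  rw [Real.norm_eq_abs, Complex.sub_re, Complex.mul_re, Complex.exp_ofReal_mul_I_re,
    Complex.exp_ofReal_mul_I_im]
  simp

/-- Solutions for different zeros of the characteristic function are orthogonal. -/
theorem integral_re_mul_conj_eq_zero (hZ : IsDiracSolutionFamily p q α Z) {l m : ℝ} (hlm : l ≠ m)
    (hl : (Z l π).re = 0) (hm : (Z m π).re = 0) :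
    ∫ x in 0..π, (Z l x * conj (Z m x)).re = 0 := by
  have h1 := ((hZ.hasACDeriv l).mul (hZ.hasACDeriv m).complex_conj).im
  have h2 : HasACDeriv (fun x => ((Z l x * conj (Z m x)).im : ℂ))
      (fun x => (((l - m) * (Z l x * conj (Z m x)).re : ℝ) : ℂ)) 0 π := by
    refine h1.congr_deriv' fun x => ?_
    congr 1
    simp [Complex.mul_re, Complex.mul_im]
    ring
  have h3 := h2.integral_eq_sub
  rw [intervalIntegral.integral_ofReal, intervalIntegral.integral_const_mul, hZ.init, hZ.init,
    Complex.mul_im, Complex.conj_re, Complex.conj_im, hl, hm, Complex.mul_conj,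
    Complex.ofReal_im] at h3
  have h4 : (l - m) * ∫ x in 0..π, (Z l x * conj (Z m x)).re = 0 := by
    simpa [← Complex.ofReal_sub] using h3
  exact (mul_eq_zero.1 h4).resolve_left (sub_ne_zero.2 hlm)

theorem eventually_re_ne_zero (hZ : IsDiracSolutionFamily p q α Z)
    (hp : IntegrableOn p (Icc 0 π)) (hq : IntegrableOn q (Icc 0 π)) (m : ℝ) :
    ∀ᶠ l in 𝓝[≠] m, (Z l π).re ≠ 0 := by
  have hπ := pi_pos.le
  have hcont : ∀ l, ContinuousOn (Z l) (Icc 0 π) := fun l => by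
    simpa [uIcc_of_le hπ] using (hZ.hasACDeriv l).continuousOn
  by_cases hm : (Z m π).re = 0
  swap
  · exact nhdsWithin_le_nhds ((Complex.continuous_re.comp
      (hZ.continuous_eval hp hq (right_mem_Icc.2 hπ))).continuousAt.eventually_ne hm)
  obtain ⟨K, hK⟩ := hZ.exists_norm_sub_le hp hq
  have hpos : 0 < ∫ x in 0..π, (Z m x * conj (Z m x)).re := by
    refine intervalIntegral.integral_pos pi_pos ?_ (fun x _ => ?_) ⟨0, left_mem_Icc.2 hπ, ?_⟩
    · have := hcont m
      exact Complex.continuous_re.comp_continuousOn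
        (this.mul (Complex.continuous_conj.comp_continuousOn this))
    · rw [Complex.mul_conj, Complex.ofReal_re]
      exact Complex.normSq_nonneg _
    · rw [Complex.mul_conj, Complex.ofReal_re, Complex.normSq_pos, hZ.init]
      simp
  have hlim : Tendsto (fun l => ∫ x in 0..π, (Z l x * conj (Z m x)).re) (𝓝[≠] m)
      (𝓝 (∫ x in 0..π, (Z m x * conj (Z m x)).re)) := by
    obtain ⟨B, hB⟩ := isCompact_Icc.exists_bound_of_continuousOn (hcont m)
    have hB0 : 0 ≤ B := (norm_nonneg _).trans (hB 0 (left_mem_Icc.2 hπ))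
    refine Tendsto.mono_left ?_ nhdsWithin_le_nhds
    have hint : ∀ l, IntervalIntegrable (fun x => (Z l x * conj (Z m x)).re) volume 0 π := by
      intro l
      refine ContinuousOn.intervalIntegrable ?_
      rw [uIcc_of_le hπ]
      exact Complex.continuous_re.comp_continuousOn
        ((hcont l).mul (Complex.continuous_conj.comp_continuousOn (hcont m)))
    rw [tendsto_iff_norm_sub_tendsto_zero]
    refine squeeze_zero (g := fun l => K * |l - m| * B * |π - 0|) (fun _ => norm_nonneg _)
      (fun l => ?_) ?_
    · rw [← intervalIntegral.integral_sub (hint l) (hint m)]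
      refine intervalIntegral.norm_integral_le_of_norm_le_const fun x hx => ?_
      rw [uIoc_of_le hπ] at hx
      have hx' := Ioc_subset_Icc_self hx
      rw [← Complex.sub_re, ← sub_mul, Real.norm_eq_abs]
      refine (Complex.abs_re_le_norm _).trans ?_
      rw [norm_mul, RCLike.norm_conj]
      exact mul_le_mul (hK l m x hx') (hB x hx') (norm_nonneg _)
        ((norm_nonneg _).trans (hK l m x hx'))
    · have : Continuous fun l => K * |l - m| * B * |π - 0| := by fun_prop
      simpa using this.tendsto m
  filter_upwards [hlim.eventually_const_lt hpos, self_mem_nhdsWithin] with l hl hne h0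
  exact hl.ne' (hZ.integral_re_mul_conj_eq_zero hne h0 hm)

theorem eq_mul_of_init (hZ : IsDiracSolutionFamily p q α Z) (hp : IntegrableOn p (Icc 0 π))
    (hq : IntegrableOn q (Icc 0 π)) {f : ℝ → ℂ} {l r : ℝ}
    (hf : HasACDeriv f (fun x => Complex.I * l * f x + diracCoeff p q x * conj (f x)) 0 π)
    (h0 : f 0 = r * (Complex.I * Complex.exp (α * Complex.I))) {x : ℝ} (hx : x ∈ Icc 0 π) :
    f x = r * Z l x := by
  have h1 := (hf.sub ((hZ.hasACDeriv l).const_mul (r : ℂ))).congr_deriv'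
    (g' := fun x => Complex.I * l * (f x - r * Z l x) +
      diracCoeff p q x * conj (f x - r * Z l x)) fun x => by
        simp only [map_sub, map_mul, Complex.conj_ofReal]
        ring
  exact sub_eq_zero.1 (eq_zero_of_hasACDeriv pi_pos.le (intervalIntegrable_diracCoeff hp hq) h1
    (by rw [h0, hZ.init, sub_self]) hx)

end IsDiracSolutionFamily

/-! ### Eigenvalues are the zeros of the characteristic function -/

theorem diracExpr_apply_zero (p q : ℝ → ℝ) (y : ℝ → Fin 2 → ℂ) (x : ℝ) :
    diracExpr p q y x 0 = deriv (fun t => y t 1) x + (p x * y x 0 + q x * y x 1) := by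
  simp [diracExpr, diracB, diracPotential, dotProduct, Fin.sum_univ_two]

theorem diracExpr_apply_one (p q : ℝ → ℝ) (y : ℝ → Fin 2 → ℂ) (x : ℝ) :
    diracExpr p q y x 1 = -deriv (fun t => y t 0) x + (q x * y x 0 - p x * y x 1) := by
  simp [diracExpr, diracB, diracPotential, dotProduct, Fin.sum_univ_two]
  ring

theorem AbsolutelyContinuousOnInterval.hasACDeriv_deriv {f : ℝ → ℂ} {a b : ℝ}
    (hf : AbsolutelyContinuousOnInterval f a b) : HasACDeriv f (deriv f) a b :=
  ⟨hf, by filter_upwards [hf.complex_ae_differentiableAt] with x hx hx' using (hx hx').hasDerivAt⟩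

section Eigenfunction

variable {y : ℝ → Fin 2 → ℂ} {z : ℂ}

/-- Both functions `y₁ + σ i y₂`, `σ = ± 1`, of an eigenfunction solve a scalar equation. -/
theorem hasACDeriv_add_mul_I (hy : ∀ k, AbsolutelyContinuousOnInterval (fun x => y x k) 0 π)
    (he : ∀ᵐ x ∂(volume.restrict (Icc 0 π)), diracExpr p q y x = z • y x) :
    HasACDeriv (fun x => y x 0 + Complex.I * y x 1)
      (fun x => Complex.I * z * (y x 0 + Complex.I * y x 1) +
        diracCoeff p q x * (y x 0 + -Complex.I * y x 1)) 0 π ∧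
    HasACDeriv (fun x => y x 0 + -Complex.I * y x 1)
      (fun x => -(Complex.I * z * (y x 0 + -Complex.I * y x 1)) +
        conj (diracCoeff p q x) * (y x 0 + Complex.I * y x 1)) 0 π := by
  have h0 := (hy 0).hasACDeriv_deriv
  have h1 := (hy 1).hasACDeriv_deriv
  rw [ae_restrict_iff' measurableSet_Icc] at he
  constructor
  · refine (h0.add (h1.const_mul Complex.I)).congr_deriv ?_
    filter_upwards [he] with x hx hx'
    rw [uIcc_of_le pi_pos.le] at hx'
    have e0 := congrFun (hx hx') 0
    have e1 := congrFun (hx hx') 1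
    rw [diracExpr_apply_zero, Pi.smul_apply, smul_eq_mul] at e0
    rw [diracExpr_apply_one, Pi.smul_apply, smul_eq_mul] at e1
    rw [diracCoeff]
    linear_combination Complex.I * e0 - e1 - (z * y x 1 + p x * y x 1) * Complex.I_sq
  · refine (h0.add (h1.const_mul (-Complex.I))).congr_deriv ?_
    filter_upwards [he] with x hx hx'
    rw [uIcc_of_le pi_pos.le] at hx'
    have e0 := congrFun (hx hx') 0
    have e1 := congrFun (hx hx') 1
    rw [diracExpr_apply_zero, Pi.smul_apply, smul_eq_mul] at e0
    rw [diracExpr_apply_one, Pi.smul_apply, smul_eq_mul] at e1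
    rw [diracCoeff]
    simp only [map_sub, map_mul, Complex.conj_ofReal, Complex.conj_I]
    linear_combination -Complex.I * e0 - e1 - (z * y x 1 + p x * y x 1) * Complex.I_sq

/-- Dirac operators are symmetric, so their eigenvalues are real. -/
theorem im_eq_zero_of_isDiracEigenvalue (hz : IsDiracEigenvalue p q α z) : z.im = 0 := by
  obtain ⟨y, ⟨hac, -, h0, hπ⟩, ⟨x₀, hx₀, hne⟩, he⟩ := hz
  obtain ⟨hU, hV⟩ := hasACDeriv_add_mul_I hac he
  set U : ℝ → ℂ := fun x => y x 0 + Complex.I * y x 1 with hUdef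
  set V : ℝ → ℂ := fun x => y x 0 + -Complex.I * y x 1 with hVdef
  have hE : HasACDeriv (fun x => U x * conj (U x) - V x * conj (V x))
      (fun x => -2 * z.im * ((Complex.normSq (U x) + Complex.normSq (V x) : ℝ) : ℂ)) 0 π := by
    refine ((hU.mul hU.complex_conj).sub (hV.mul hV.complex_conj)).congr_deriv' fun x => ?_
    have e : (2 * z.im : ℂ) * Complex.I = z - conj z := by
      rw [Complex.sub_conj]
      push_cast
      ring
    have e' : (-2 * z.im : ℂ) = Complex.I * (z - conj z) := by
      rw [← e]
      linear_combination (-2 * (z.im : ℂ)) * Complex.I_sq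
    rw [e', Complex.ofReal_add, ← Complex.mul_conj, ← Complex.mul_conj]
    simp only [hUdef, hVdef, map_add, map_neg, map_mul, Complex.conj_I, Complex.conj_conj]
    ring
  have hEint := hE.integral_eq_sub
  have hcs : (Real.cos α : ℂ) ^ 2 + (Real.sin α : ℂ) ^ 2 = 1 := by
    exact_mod_cast Real.cos_sq_add_sin_sq α
  have h0c : conj (y 0 0) * (Real.cos α : ℂ) + conj (y 0 1) * (Real.sin α : ℂ) = 0 := by
    simpa only [map_add, map_mul, Complex.conj_ofReal, map_zero] using congrArg conj h0
  have hE0 : U 0 * conj (U 0) - V 0 * conj (V 0) = 0 := by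
    simp only [hUdef, hVdef, map_add, map_neg, map_mul, Complex.conj_I]
    linear_combination (2 * Complex.I * (y 0 1 * conj (y 0 0) - y 0 0 * conj (y 0 1))) * (-hcs)
      + 2 * Complex.I * (y 0 1 * (Real.cos α : ℂ) - y 0 0 * (Real.sin α : ℂ)) * h0c
      + 2 * Complex.I * (conj (y 0 0) * (Real.sin α : ℂ) - conj (y 0 1) * (Real.cos α : ℂ)) * h0
  have hEπ : U π * conj (U π) - V π * conj (V π) = 0 := by
    simp only [hUdef, hVdef, map_add, map_neg, map_mul, Complex.conj_I, hπ, map_zero]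
    ring
  have hint : (-2 * z.im) * ∫ x in 0..π, (Complex.normSq (U x) + Complex.normSq (V x)) = 0 := by
    rw [intervalIntegral.integral_const_mul, intervalIntegral.integral_ofReal, hE0, hEπ,
      sub_zero] at hEint
    exact_mod_cast hEint
  have hpos : 0 < ∫ x in 0..π, (Complex.normSq (U x) + Complex.normSq (V x)) := by
    have hUc := hU.continuousOn
    have hVc := hV.continuousOn
    rw [uIcc_of_le pi_pos.le] at hUc hVc
    refine intervalIntegral.integral_pos pi_pos
      ((Complex.continuous_normSq.comp_continuousOn hUc).add
        (Complex.continuous_normSq.comp_continuousOn hVc))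
      (fun x _ => add_nonneg (Complex.normSq_nonneg _) (Complex.normSq_nonneg _)) ⟨x₀, hx₀, ?_⟩
    by_contra hcon
    have h1 := Complex.normSq_nonneg (U x₀)
    have h2 := Complex.normSq_nonneg (V x₀)
    have h3 : U x₀ = 0 := Complex.normSq_eq_zero.1 (by linarith)
    have h4 : V x₀ = 0 := Complex.normSq_eq_zero.1 (by linarith)
    simp only [hUdef, hVdef] at h3 h4
    refine hne (funext fun k => ?_)
    have h5 : y x₀ 0 = 0 := by linear_combination (h3 + h4) / 2
    have h6 : y x₀ 1 = 0 := by
      linear_combination (-Complex.I / 2) * (h3 - h4) + y x₀ 1 * Complex.I_sq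
    fin_cases k <;> assumption
  have := (mul_eq_zero.1 hint).resolve_right hpos.ne'
  linarith

end Eigenfunction

namespace IsDiracSolutionFamily

theorem re_eq_zero_of_isDiracEigenvalue (hZ : IsDiracSolutionFamily p q α Z)
    (hp : IntegrableOn p (Icc 0 π)) (hq : IntegrableOn q (Icc 0 π)) {l : ℝ}
    (hl : IsDiracEigenvalue p q α l) : (Z l π).re = 0 := by
  obtain ⟨y, ⟨hac, -, h0, hπ⟩, ⟨x₀, hx₀, hne⟩, he⟩ := hl
  obtain ⟨hU, hV⟩ := hasACDeriv_add_mul_I hac he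
  have key : ∀ a : ℂ, ∀ x ∈ Icc 0 π, (((a * y x 0).re : ℝ) : ℂ) +
      Complex.I * (((a * y x 1).re : ℝ) : ℂ) =
        (((a * y 0 1).re * Real.cos α - (a * y 0 0).re * Real.sin α : ℝ) : ℂ) * Z l x := by
    intro a x hx
    have e2 : ∀ w : ℂ, ((w.re : ℝ) : ℂ) = (w + conj w) / 2 := fun w => by
      rw [Complex.add_conj]; push_cast; ring
    have hd := (((hU.const_mul a).add (hV.const_mul a).complex_conj).const_mul (1 / 2)).congr_deriv'
      (g' := fun x => Complex.I * l * ((1 / 2) * (a * (y x 0 + Complex.I * y x 1) +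
          conj (a * (y x 0 + -Complex.I * y x 1)))) +
        diracCoeff p q x * conj ((1 / 2) * (a * (y x 0 + Complex.I * y x 1) +
          conj (a * (y x 0 + -Complex.I * y x 1))))) fun x => by
        simp only [map_add, map_neg, map_mul, Complex.conj_I, Complex.conj_conj,
          Complex.conj_ofReal, map_div₀, map_one, map_ofNat]
        ring
    refine Eq.trans ?_ (hZ.eq_mul_of_init hp hq hd ?_ hx)
    · simp only [e2, map_add, map_neg, map_mul, Complex.conj_I]
      ring
    · have hre : (a * y 0 0).re * Real.cos α + (a * y 0 1).re * Real.sin α = 0 := by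
        have h3 := congrArg (fun w => (a * w).re) h0
        simp only [mul_add, ← mul_assoc, Complex.add_re, mul_zero, Complex.zero_re,
          Complex.re_mul_ofReal] at h3
        exact h3
      have hcs := Real.cos_sq_add_sin_sq α
      have e3 : (1 / 2 : ℂ) * (a * (y 0 0 + Complex.I * y 0 1) +
          conj (a * (y 0 0 + -Complex.I * y 0 1))) =
          (((a * y 0 0).re : ℝ) : ℂ) + Complex.I * (((a * y 0 1).re : ℝ) : ℂ) := by
        simp only [e2, map_add, map_neg, map_mul, Complex.conj_I]
        ring
      rw [e3]
      apply Complex.ext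
      · rw [Complex.re_ofReal_mul, Complex.I_mul_re, Complex.exp_ofReal_mul_I_im]
        simp only [Complex.add_re, Complex.ofReal_re, Complex.I_mul_re, Complex.ofReal_im]
        linear_combination (-(a * y 0 0).re) * hcs + Real.cos α * hre
      · rw [Complex.im_ofReal_mul, Complex.I_mul_im, Complex.exp_ofReal_mul_I_re]
        simp only [Complex.add_im, Complex.ofReal_re, Complex.I_mul_im, Complex.ofReal_im]
        linear_combination (-(a * y 0 1).re) * hcs + Real.sin α * hre
  have main : ∀ a : ℂ, (a * y x₀ 0).re ≠ 0 ∨ (a * y x₀ 1).re ≠ 0 → (Z l π).re = 0 := by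
    intro a ha
    have hr : (a * y 0 1).re * Real.cos α - (a * y 0 0).re * Real.sin α ≠ 0 := by
      intro hr
      have h1 := key a x₀ hx₀
      rw [hr, Complex.ofReal_zero, zero_mul] at h1
      have h2 := congrArg Complex.re h1
      have h3 := congrArg Complex.im h1
      simp only [Complex.add_re, Complex.ofReal_re, Complex.I_mul_re, Complex.ofReal_im,
        Complex.zero_re, neg_zero, add_zero, Complex.add_im, Complex.I_mul_im, Complex.zero_im,
        zero_add] at h2 h3
      tauto
    have h1 := congrArg Complex.re (key a π (right_mem_Icc.2 pi_pos.le))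
    rw [hπ, Complex.re_ofReal_mul] at h1
    simp only [mul_zero, Complex.zero_re, Complex.ofReal_zero, zero_add, Complex.I_mul_re,
      Complex.ofReal_im, neg_zero] at h1
    exact (mul_eq_zero.1 h1.symm).resolve_left hr
  by_contra hcon
  have m1 := mt (main 1) hcon
  have m2 := mt (main Complex.I) hcon
  simp only [one_mul, Complex.I_mul_re, not_or, not_not, neg_eq_zero] at m1 m2
  refine hne (funext fun k => ?_)
  fin_cases k
  · exact Complex.ext m1.1 m2.1
  · exact Complex.ext m1.2 m2.2

theorem isDiracEigenvalue_of_re_eq_zero (hZ : IsDiracSolutionFamily p q α Z) {l : ℝ}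
    (hl : (Z l π).re = 0) : IsDiracEigenvalue p q α l := by
  have hd := hZ.hasACDeriv l
  have h0 := hZ.init l
  set y : ℝ → Fin 2 → ℂ := fun x => ![((Z l x).re : ℂ), ((Z l x).im : ℂ)] with hy
  have he : ∀ᵐ x ∂(volume.restrict (Icc 0 π)), diracExpr p q y x = (l : ℂ) • y x := by
    rw [ae_restrict_iff' measurableSet_Icc]
    filter_upwards [hd.re.ae_hasDerivAt, hd.im.ae_hasDerivAt] with x h1 h2 hx
    rw [← uIcc_of_le pi_pos.le] at hx
    have e1 : deriv (fun t => y t 0) x = _ := (h1 hx).deriv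
    have e2 : deriv (fun t => y t 1) x = _ := (h2 hx).deriv
    ext k
    fin_cases k
    · refine (diracExpr_apply_zero p q y x).trans ?_
      rw [e2]
      simp only [hy, diracCoeff, Pi.smul_apply, smul_eq_mul]
      simp
      ring
    · refine (diracExpr_apply_one p q y x).trans ?_
      rw [e1]
      simp only [hy, diracCoeff, Pi.smul_apply, smul_eq_mul]
      simp
      ring
  have hac : ∀ k, AbsolutelyContinuousOnInterval (fun x => y x k) 0 π := by
    intro k
    fin_cases k
    · exact hd.re.ac
    · exact hd.im.ac
  refine ⟨y, ⟨hac, fun k => ?_, ?_, ?_⟩, ⟨0, left_mem_Icc.2 pi_pos.le, fun hy0 => ?_⟩, he⟩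
  · have hc := (hac k).continuousOn
    rw [uIcc_of_le pi_pos.le] at hc
    obtain ⟨C, hC⟩ := isCompact_Icc.exists_bound_of_continuousOn hc
    have hm : MemLp (fun x => (l : ℂ) * y x k) 2 (volume.restrict (Icc 0 π)) := by
      refine MemLp.const_mul (MemLp.of_bound (hc.aestronglyMeasurable measurableSet_Icc) C ?_) _
      rw [ae_restrict_iff' measurableSet_Icc]
      exact ae_of_all _ hC
    refine (memLp_congr_ae ?_).2 hm
    filter_upwards [he] with x hx
    rw [hx, Pi.smul_apply, smul_eq_mul]
  · have e1 : y 0 0 = -(Real.sin α : ℂ) := by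
      change ((Z l 0).re : ℂ) = _
      rw [h0, Complex.I_mul_re, Complex.exp_ofReal_mul_I_im, Complex.ofReal_neg]
    have e2 : y 0 1 = (Real.cos α : ℂ) := by
      change ((Z l 0).im : ℂ) = _
      rw [h0, Complex.I_mul_im, Complex.exp_ofReal_mul_I_re]
    rw [e1, e2]
    ring
  · change ((Z l π).re : ℂ) = 0
    rw [hl, Complex.ofReal_zero]
  · have e1 : ((Z l 0).re : ℂ) = 0 := congrFun hy0 0
    have e2 : ((Z l 0).im : ℂ) = 0 := congrFun hy0 1
    have : Z l 0 ≠ 0 := by rw [h0]; simp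
    exact this (Complex.ext (by exact_mod_cast e1) (by exact_mod_cast e2))

theorem isDiracEigenvalue_iff (hZ : IsDiracSolutionFamily p q α Z)
    (hp : IntegrableOn p (Icc 0 π)) (hq : IntegrableOn q (Icc 0 π)) (z : ℂ) :
    IsDiracEigenvalue p q α z ↔ ∃ l : ℝ, (Z l π).re = 0 ∧ z = l := by
  constructor
  · intro hz
    have e : z = (z.re : ℂ) :=
      Complex.ext (by simp) (by simpa using im_eq_zero_of_isDiracEigenvalue hz)
    exact ⟨z.re, hZ.re_eq_zero_of_isDiracEigenvalue hp hq (e ▸ hz), e⟩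
  · rintro ⟨l, hl, rfl⟩
    exact hZ.isDiracEigenvalue_of_re_eq_zero hl

end IsDiracSolutionFamily

/-! ### Enumeration of the spectrum -/

theorem Set.exists_strictMono_int_range_eq {S : Set ℝ} (hfin : ∀ a b, (S ∩ Icc a b).Finite)
    (hup : ∀ a, ∃ x ∈ S, a < x) (hdown : ∀ a, ∃ x ∈ S, x < a) :
    ∃ f : ℤ → ℝ, StrictMono f ∧ range f = S := by
  let : LocallyFiniteOrder S := LocallyFiniteOrder.ofFiniteIcc fun a b =>
    Set.Finite.of_finite_image ((hfin a b).subset (by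
      rintro _ ⟨x, hx, rfl⟩
      exact ⟨x.2, hx.1, hx.2⟩)) Subtype.val_injective.injOn
  let := LinearLocallyFiniteOrder.succOrder S
  let := LinearLocallyFiniteOrder.predOrder S
  have : NoMaxOrder S := ⟨fun a => let ⟨x, hx, h⟩ := hup a; ⟨⟨x, hx⟩, h⟩⟩
  have : NoMinOrder S := ⟨fun a => let ⟨x, hx, h⟩ := hdown a; ⟨⟨x, hx⟩, h⟩⟩
  have : Nonempty S := let ⟨x, hx, _⟩ := hup 0; ⟨⟨x, hx⟩⟩
  let e : S ≃o ℤ := orderIsoIntOfLinearSuccPredArch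
  refine ⟨fun n => e.symm n, fun m n h => e.symm.strictMono h, ?_⟩
  ext x
  exact ⟨by rintro ⟨n, rfl⟩; exact (e.symm n).2, fun hx => ⟨e ⟨x, hx⟩, by simp⟩⟩

theorem exists_nearest_zero {S : Set ℝ} (hfin : ∀ a b, (S ∩ Icc a b).Finite) (hne : S.Nonempty) :
    ∃ m ∈ S, (∀ x ∈ S, |m| ≤ |x|) ∧ ∀ x ∈ S, |x| = |m| → m ≤ x := by
  obtain ⟨x₀, hx₀⟩ := hne
  obtain ⟨m, hm, hmin⟩ := Set.exists_min_image _ (fun x : ℝ => |x|) (hfin (-|x₀|) |x₀|)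
    ⟨x₀, hx₀, neg_abs_le _, le_abs_self _⟩
  have hmin' : ∀ x ∈ S, |m| ≤ |x| := by
    intro x hx
    rcases le_total |x| |x₀| with h | h
    · exact hmin x ⟨hx, abs_le.1 h⟩
    · exact (abs_le.2 hm.2).trans h
  by_cases hneg : -|m| ∈ S
  · refine ⟨-|m|, hneg, by simpa using hmin', fun x _ hx => ?_⟩
    rw [abs_neg, abs_abs] at hx
    rw [← hx]
    exact neg_abs_le x
  · refine ⟨m, hm.1, hmin', fun x hx hxm => ?_⟩
    have hm0 : m = |m| := by
      rcases abs_choice m with h | h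
      · exact h.symm
      · exact absurd (by rw [h, neg_neg]; exact hm.1) hneg
    rcases abs_choice x with h | h
    · rw [← h, hxm]
      exact le_abs_self m
    · exact absurd (by rw [← hxm, h, neg_neg]; exact hx) hneg

namespace IsDiracSolutionFamily

theorem finite_zeros_inter_Icc (hZ : IsDiracSolutionFamily p q α Z)
    (hp : IntegrableOn p (Icc 0 π)) (hq : IntegrableOn q (Icc 0 π)) (a b : ℝ) :
    ({l | (Z l π).re = 0} ∩ Icc a b).Finite := by
  by_contra hinf
  obtain ⟨m, -, hm⟩ := Set.Infinite.exists_accPt_of_subset_isCompact hinf isCompact_Icc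
    inter_subset_right
  rw [accPt_iff_frequently_nhdsNE] at hm
  obtain ⟨l, hl, hl'⟩ := (hm.and_eventually (hZ.eventually_re_ne_zero hp hq m)).exists
  exact hl' hl.1

theorem eventually_exists_zero (hZ : IsDiracSolutionFamily p q α Z)
    (hp : IntegrableOn p (Icc 0 π)) (hq : IntegrableOn q (Icc 0 π))
    {F : Filter ℝ} [F.IsCountablyGenerated] (hF : F ≤ cocompact ℝ) {G : Filter ℤ}
    (hG : ∀ c : ℝ, Tendsto (fun k : ℤ => 2 * (k : ℝ) + c) G F) :
    ∀ᶠ k : ℤ in G, ∃ l ∈ Icc (2 * (k : ℝ) + (1 / 2 - α / π)) (2 * (k : ℝ) + (3 / 2 - α / π)),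
      (Z l π).re = 0 := by
  have hlim := hZ.tendsto_re_add_sin hp hq hF
  have hlt : ∀ᶠ l in F, |(Z l π).re + Real.sin (l * π + α)| < 1 := by
    simpa using hlim.abs.eventually_lt_const (show |(0 : ℝ)| < 1 by simp)
  have hcont : Continuous fun l => (Z l π).re :=
    Complex.continuous_re.comp (hZ.continuous_eval hp hq (right_mem_Icc.2 pi_pos.le))
  filter_upwards [(hG (1 / 2 - α / π)).eventually hlt, (hG (3 / 2 - α / π)).eventually hlt]
    with k h1 h2
  have s1 : Real.sin ((2 * (k : ℝ) + (1 / 2 - α / π)) * π + α) = 1 := by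
    have : (2 * (k : ℝ) + (1 / 2 - α / π)) * π + α = π / 2 + k * (2 * π) := by
      field_simp
      ring
    rw [this, Real.sin_add_int_mul_two_pi, Real.sin_pi_div_two]
  have s2 : Real.sin ((2 * (k : ℝ) + (3 / 2 - α / π)) * π + α) = -1 := by
    have : (2 * (k : ℝ) + (3 / 2 - α / π)) * π + α = (π / 2 + π) + k * (2 * π) := by
      field_simp
      ring
    rw [this, Real.sin_add_int_mul_two_pi, Real.sin_add_pi, Real.sin_pi_div_two]
  rw [s1, abs_lt] at h1
  rw [s2, abs_lt] at h2
  exact intermediate_value_Icc (by linarith) hcont.continuousOn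
    ⟨by linarith, by linarith⟩

theorem exists_zero_gt (hZ : IsDiracSolutionFamily p q α Z)
    (hp : IntegrableOn p (Icc 0 π)) (hq : IntegrableOn q (Icc 0 π)) (a : ℝ) :
    ∃ l, (Z l π).re = 0 ∧ a < l := by
  have hG : ∀ c : ℝ, Tendsto (fun k : ℤ => 2 * (k : ℝ) + c) atTop atTop := fun c =>
    tendsto_atTop_add_const_right _ _ (tendsto_intCast_atTop_atTop.const_mul_atTop two_pos)
  obtain ⟨k, ⟨l, hl, hl0⟩, hk⟩ := ((hZ.eventually_exists_zero hp hq atTop_le_cocompact hG).and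
    ((hG _).eventually_gt_atTop a)).exists
  exact ⟨l, hl0, hk.trans_le hl.1⟩

theorem exists_zero_lt (hZ : IsDiracSolutionFamily p q α Z)
    (hp : IntegrableOn p (Icc 0 π)) (hq : IntegrableOn q (Icc 0 π)) (a : ℝ) :
    ∃ l, (Z l π).re = 0 ∧ l < a := by
  have hG : ∀ c : ℝ, Tendsto (fun k : ℤ => 2 * (k : ℝ) + c) atBot atBot := fun c =>
    tendsto_atBot_add_const_right _ _
      ((tendsto_intCast_atBot_iff.2 tendsto_id).const_mul_atBot two_pos)
  obtain ⟨k, ⟨l, hl, hl0⟩, hk⟩ := ((hZ.eventually_exists_zero hp hq atBot_le_cocompact hG).and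
    ((hG _).eventually_lt_atBot a)).exists
  exact ⟨l, hl0, hl.2.trans_lt hk⟩

theorem exists_isDiracEnumeration (hZ : IsDiracSolutionFamily p q α Z)
    (hp : IntegrableOn p (Icc 0 π)) (hq : IntegrableOn q (Icc 0 π)) :
    ∃ lam, IsDiracEnumeration p q α lam := by
  have hfin := hZ.finite_zeros_inter_Icc hp hq
  obtain ⟨f, hf, hrange⟩ := Set.exists_strictMono_int_range_eq hfin (hZ.exists_zero_gt hp hq)
    (hZ.exists_zero_lt hp hq)
  obtain ⟨m, hmS, hmin, htie⟩ := exists_nearest_zero hfin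
    (let ⟨l, hl, _⟩ := hZ.exists_zero_gt hp hq 0; ⟨l, hl⟩)
  obtain ⟨n₀, hn₀⟩ : m ∈ range f := hrange ▸ hmS
  have hmem : ∀ k, f k ∈ {l | (Z l π).re = 0} := fun k => hrange ▸ mem_range_self k
  refine ⟨fun k => f (k + n₀), fun j k h => hf (by omega), fun z => ?_, fun k hk => ?_,
    fun k hk => ?_, fun k => ?_, fun k hk => ?_⟩
  · rw [hZ.isDiracEigenvalue_iff hp hq]
    constructor
    · rintro ⟨l, hl, rfl⟩
      obtain ⟨k, rfl⟩ : l ∈ range f := hrange ▸ hl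
      exact ⟨k - n₀, by simp⟩
    · rintro ⟨k, rfl⟩
      exact ⟨_, hmem _, rfl⟩
  · have h1 : m < f (k + n₀) := hn₀ ▸ hf (by omega)
    have h2 := hmin _ (hmem (k + n₀))
    by_contra! h3
    rw [abs_of_nonpos (h1.le.trans h3), abs_of_nonpos h3] at h2
    linarith
  · have h1 : f (k + n₀) < m := hn₀ ▸ hf (by omega)
    have h2 := hmin _ (hmem (k + n₀))
    by_contra! h3
    rw [abs_of_nonneg (h3.trans h1.le), abs_of_nonneg h3] at h2
    linarith
  · simpa [hn₀] using hmin _ (hmem _)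
  · simp only [zero_add, hn₀] at hk ⊢
    exact htie _ (hmem _) hk

end IsDiracSolutionFamily

theorem isDiracEnumeration_diracEigenvalue {p q : ℝ → ℝ} (hp : IntegrableOn p (Icc 0 π))
    (hq : IntegrableOn q (Icc 0 π)) (α : ℝ) :
    IsDiracEnumeration p q α (diracEigenvalue p q α) :=
  let ⟨_, hZ⟩ := exists_isDiracSolutionFamily hp hq α
  Classical.epsilon_spec (hZ.exists_isDiracEnumeration hp hq)

end

theorem lemma1p1 (p q p' q' : ℝ → ℝ) (α α' : ℝ)
    (hp : IntegrableOn p (Icc 0 π)) (hq : IntegrableOn q (Icc 0 π))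
    (hp' : IntegrableOn p' (Icc 0 π)) (hq' : IntegrableOn q' (Icc 0 π))
    (hα : α ∈ Ioc (-(π / 2)) (π / 2)) (hα' : α' ∈ Ioc (-(π / 2)) (π / 2))
    (hiso : DiracIsospectral p q α p' q' α') :
    α' = α := by
  obtain ⟨Z, hZ⟩ := exists_isDiracSolutionFamily hp hq α
  obtain ⟨Z', hZ'⟩ := exists_isDiracSolutionFamily hp' hq' α'
  have hspec : ∀ l : ℝ, (Z l π).re = 0 → (Z' l π).re = 0 := by
    intro l hl
    obtain ⟨n, hn⟩ := ((isDiracEnumeration_diracEigenvalue hp hq α).eigenvalue_iff l).1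
      (hZ.isDiracEigenvalue_of_re_eq_zero hl)
    rw [hiso n] at hn
    exact hZ'.re_eq_zero_of_isDiracEigenvalue hp' hq'
      (((isDiracEnumeration_diracEigenvalue hp' hq' α').eigenvalue_iff l).2 ⟨n, hn⟩)
  have h1 := hZ.tendsto_re_add_sin hp hq _root_.atTop_le_cocompact
  have h2 := hZ'.tendsto_re_add_sin hp' hq' _root_.atTop_le_cocompact
  have hsin : Real.sin (α' - α) = 0 := by
    rw [← abs_eq_zero]
    refine le_antisymm (le_of_forall_pos_lt_add fun ε hε => ?_) (abs_nonneg _)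
    obtain ⟨a, ha⟩ := Filter.eventually_atTop.1
      ((h1.abs.eventually_lt_const (show |(0 : ℝ)| < ε / 2 by simpa using hε)).and
        (h2.abs.eventually_lt_const (show |(0 : ℝ)| < ε / 2 by simpa using hε)))
    obtain ⟨l, hl, hal⟩ := hZ.exists_zero_gt hp hq a
    obtain ⟨b1, b2⟩ := ha l hal.le
    rw [hl, zero_add] at b1
    rw [hspec l hl, zero_add] at b2
    have e : Real.sin (α' - α) = Real.sin (l * π + α') * Real.cos (l * π + α) -
        Real.cos (l * π + α') * Real.sin (l * π + α) := by
      rw [← Real.sin_sub]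
      congr 1
      ring
    rw [e, zero_add]
    refine (abs_sub _ _).trans_lt ?_
    rw [abs_mul, abs_mul]
    have c1 := mul_le_of_le_one_right (abs_nonneg (Real.sin (l * π + α')))
      (Real.abs_cos_le_one (l * π + α))
    have c2 := mul_le_of_le_one_left (abs_nonneg (Real.sin (l * π + α)))
      (Real.abs_cos_le_one (l * π + α'))
    linarith
  have := (Real.sin_eq_zero_iff_of_lt_of_lt (by linarith [hα.2, hα'.1])
    (by linarith [hα.1, hα'.2])).1 hsin
  linarith
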